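/- Throughout, subgroups of profinite groups are required to be closed, homomorphisms are required to be continuous, and "generated" means topologically generated. Let $G$ be a profinite group. For a prime $p$, let $O_p(G)$ be the subgroup generated by all normal pro-$p$ subgroups of $G$, and let the Fitting subgroup $F(G)$ be the subgroup generated by the $O_p(G)$ as $p$ ranges over all primes. A profinite group $Q$ is quasisimple if it is perfect (that is, the closure of its derived group is $Q$) and $Q/Z(Q)$ is simple; a component of $G$ is a subnormal quasisimple subgroup of $G$; the layer $E(G)$ is the subgroup generated by all components of $G$; and the generalised Fitting subgroup $F^*(G)$ is the subgroup generated by $F(G)$ and $E(G)$. Say that $G$ is Fitting-degenerate if $F^*(G)=1$, and Fitting-regular if no non-trivial image of $G$ is Fitting-degenerate. Theorem E. Let $G$ be a profinite group that is not Fitting-regular. Then there is a proper closed normal subgroup $N$ of $G$ such that the (non-trivial) quotient $G/N$ is countably based (that is, its topology has a countable base) and Fitting-degenerate. -/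

import Mathlib

/-!
Subgroups of profinite groups are understood to be closed, and generation is topological
generation: every "subgroup generated by ..." below is the closure of the abstract one.
-/

namespace Profin

/-- A profinite group is pro-`p` if each of its quotients by an open normal subgroup
(all of them finite) is a `p`-group. -/
def IsProP (p : ℕ) (G : Type*) [Group G] [TopologicalSpace G] : Prop :=
  ∀ U : OpenNormalSubgroup G, IsPGroup p (G ⧸ (U : Subgroup G))

/-- The `p`-core `O_p(G)`: the closed subgroup generated by all closed normal pro-`p` subgroups. -/
def pCore (p : ℕ) (G : Type*) [Group G] [TopologicalSpace G] [IsTopologicalGroup G] :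
    Subgroup G :=
  (sSup {H : Subgroup G | IsClosed (H : Set G) ∧ H.Normal ∧ IsProP p H}).topologicalClosure

/-- The Fitting subgroup `F(G)`: the closed subgroup generated by the `O_p(G)`, `p` prime. -/
def fitting (G : Type*) [Group G] [TopologicalSpace G] [IsTopologicalGroup G] : Subgroup G :=
  (sSup {H : Subgroup G | ∃ p : ℕ, p.Prime ∧ H = pCore p G}).topologicalClosure

/-- A topological group is perfect if the closure of its derived group is the whole group. -/
def IsPerfect (G : Type*) [Group G] [TopologicalSpace G] [IsTopologicalGroup G] : Prop :=
  (commutator G).topologicalClosure = ⊤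

/-- A topological group is simple if it is nontrivial and has no closed normal subgroups apart
from the trivial one and itself. -/
def IsSimple (G : Type*) [Group G] [TopologicalSpace G] : Prop :=
  Nontrivial G ∧ ∀ N : Subgroup G, IsClosed (N : Set G) → N.Normal → N = ⊥ ∨ N = ⊤

/-- `Q` is quasisimple if `Q` is perfect and `Q / Z(Q)` is simple. -/
def IsQuasisimple (Q : Type*) [Group Q] [TopologicalSpace Q] [IsTopologicalGroup Q] : Prop :=
  IsPerfect Q ∧ IsSimple (Q ⧸ Subgroup.center Q)

/-- A component of `G`: a closed subnormal quasisimple subgroup. (Taking closures of the terms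
of a subnormal chain from a closed subgroup gives a subnormal chain of closed subgroups, so the
terms of the chain may or may not be required to be closed.) -/
def IsComponent {G : Type*} [Group G] [TopologicalSpace G] [IsTopologicalGroup G]
    (Q : Subgroup G) : Prop :=
  IsClosed (Q : Set G) ∧ Q.IsSubnormal ∧ IsQuasisimple Q

/-- The layer `E(G)`: the closed subgroup generated by all components. -/
def layer (G : Type*) [Group G] [TopologicalSpace G] [IsTopologicalGroup G] : Subgroup G :=
  (sSup {Q : Subgroup G | IsComponent Q}).topologicalClosure

/-- The generalised Fitting subgroup `F*(G)`: the closed subgroup generated by `F(G)` and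
`E(G)`. -/
def genFitting (G : Type*) [Group G] [TopologicalSpace G] [IsTopologicalGroup G] : Subgroup G :=
  (fitting G ⊔ layer G).topologicalClosure

/-- `G` is Fitting-degenerate if `F*(G)` is trivial. -/
def IsFittingDegenerate (G : Type*) [Group G] [TopologicalSpace G] [IsTopologicalGroup G] :
    Prop :=
  genFitting G = ⊥

/-- `G` is Fitting-regular if no nontrivial image of `G` is Fitting-degenerate. The (profinite)
images of a profinite group are, up to isomorphism of topological groups, its quotients by closed
normal subgroups. -/
def IsFittingRegular (G : Type*) [Group G] [TopologicalSpace G] [IsTopologicalGroup G] : Prop :=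
  ∀ (K : Subgroup G) [K.Normal], IsClosed (K : Set G) → Nontrivial (G ⧸ K) →
    ¬ IsFittingDegenerate (G ⧸ K)

end Profin

/-! Fix a closed normal `K` with `G/K` nontrivial and Fitting-degenerate. A profinite group is
Fitting-degenerate exactly when it has no nontrivial closed normal pro-`p` subgroup and no component
(`isFittingDegenerate_quotient_iff`), and both conditions on a quotient are expressed by subgroups
of `G` itself.

The key step (`exists_isOpen_forall_le`) is a compactness argument. Given an open normal `N₀ ≥ K`
and a depth `d`, some open normal `M` with `K ≤ M ≤ N₀` is such that every normal `p`-subgroup and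
every component of depth at most `d` in `G/M` lies in `N₀/M`. Otherwise the offending subgroups form
an inverse system of finite nonempty sets, whose limit is a forbidden subgroup of `G/K`. Bounding
the depth lets subnormality survive the limit.

Iterating with `d = n` gives open normal subgroups `N 0 ≥ N 1 ≥ ...`; let `N` be their intersection.
A forbidden subgroup of `G/N` would have image inside `N n / N (n+1)` for all large `n`, hence be
trivial. Moreover `G/N` embeds in a countable product of finite groups. -/

open Topology CategoryTheory

namespace Profin

/-! ### Subnormal depth and images modulo a normal subgroup. -/

section Subnormal

variable {G G' : Type*} [Group G] [Group G']

/-- The descending chain of iterated normal closures of `H` in `G`. -/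
def iterNormalClosure (H : Subgroup G) : ℕ → Subgroup G
  | 0 => ⊤
  | n + 1 => Subgroup.closure {x | ∃ g ∈ iterNormalClosure H n, ∃ h ∈ H, x = g * h * g⁻¹}

theorem le_iterNormalClosure (H : Subgroup G) (n : ℕ) : H ≤ iterNormalClosure H n := by
  induction n with
  | zero => exact le_top
  | succ n _ =>
    intro h hh
    exact Subgroup.subset_closure ⟨1, one_mem _, h, hh, by simp⟩

theorem iterNormalClosure_succ_le (H : Subgroup G) (n : ℕ) :
    iterNormalClosure H (n + 1) ≤ iterNormalClosure H n := by
  rw [iterNormalClosure, Subgroup.closure_le]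
  rintro _ ⟨g, hg, h, hh, rfl⟩
  exact mul_mem (mul_mem hg (le_iterNormalClosure H n hh)) (inv_mem hg)

theorem iterNormalClosure_antitone (H : Subgroup G) : Antitone (iterNormalClosure H) :=
  antitone_nat_of_succ_le (iterNormalClosure_succ_le H)

theorem iterNormalClosure_mono {H K : Subgroup G} (hHK : H ≤ K) (n : ℕ) :
    iterNormalClosure H n ≤ iterNormalClosure K n := by
  induction n with
  | zero => exact le_rfl
  | succ n ih =>
    refine Subgroup.closure_mono ?_
    rintro _ ⟨g, hg, h, hh, rfl⟩
    exact ⟨g, ih hg, h, hHK hh, rfl⟩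

theorem map_iterNormalClosure {f : G →* G'} (hf : Function.Surjective f) (H : Subgroup G)
    (n : ℕ) : (iterNormalClosure H n).map f = iterNormalClosure (H.map f) n := by
  induction n with
  | zero => exact Subgroup.map_top_of_surjective f hf
  | succ n ih =>
    rw [iterNormalClosure, iterNormalClosure, MonoidHom.map_closure, ← ih]
    congr 1
    ext x
    constructor
    · rintro ⟨_, ⟨g, hg, h, hh, rfl⟩, rfl⟩
      exact ⟨f g, ⟨g, hg, rfl⟩, f h, ⟨h, hh, rfl⟩, by simp⟩
    · rintro ⟨_, ⟨g, hg, rfl⟩, _, ⟨h, hh, rfl⟩, rfl⟩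
      exact ⟨g * h * g⁻¹, ⟨g, hg, h, hh, rfl⟩, by simp⟩

theorem iterNormalClosure_isSubnormal (H : Subgroup G) (n : ℕ) :
    (iterNormalClosure H n).IsSubnormal := by
  induction n with
  | zero => exact .top
  | succ n ih =>
    refine .step _ _ (iterNormalClosure_succ_le H n) ih ?_
    rw [Subgroup.normal_subgroupOf_iff (iterNormalClosure_succ_le H n)]
    intro x g hx hg
    rw [iterNormalClosure] at hx ⊢
    induction hx using Subgroup.closure_induction with
    | mem x hx =>
      obtain ⟨a, ha, h, hh, rfl⟩ := hx
      exact Subgroup.subset_closure ⟨g * a, mul_mem hg ha, h, hh, by group⟩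
    | one => simp
    | mul x y _ _ hx hy => simpa [mul_assoc] using mul_mem hx hy
    | inv x _ hx => simpa [mul_assoc] using inv_mem hx

/-- The iterated normal closures lie below the terms of any subnormal chain ending at `H`. The
number `d` bounds the depth, in a form that passes to images and limits. -/
theorem isSubnormal_iff_iterNormalClosure_le (H : Subgroup G) :
    H.IsSubnormal ↔ ∃ d, iterNormalClosure H d ≤ H := by
  constructor
  · intro h
    induction h with
    | top => exact ⟨0, le_top⟩
    | step H K hle _ hN ih =>
      obtain ⟨d, hd⟩ := ih
      rw [Subgroup.normal_subgroupOf_iff hle] at hN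
      refine ⟨d + 1, ?_⟩
      rw [iterNormalClosure, Subgroup.closure_le]
      rintro _ ⟨g, hg, h, hh, rfl⟩
      exact hN h g hh (hd (iterNormalClosure_mono hle d hg))
  · rintro ⟨d, hd⟩
    rw [← hd.antisymm (le_iterNormalClosure H d)]
    exact iterNormalClosure_isSubnormal H d

/-- Modulo `M` the subgroups `H ⊔ M` and `H` agree, and the chain commutes with surjections. -/
theorem iterNormalClosure_sup_le {H M : Subgroup G} [M.Normal] {d : ℕ}
    (h : iterNormalClosure H d ≤ H) : iterNormalClosure (H ⊔ M) d ≤ H ⊔ M := by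
  have hM : Subgroup.map (QuotientGroup.mk' M) (H ⊔ M) = H.map (QuotientGroup.mk' M) := by
    rw [Subgroup.map_sup, QuotientGroup.map_mk'_self, sup_bot_eq]
  have h1 : (iterNormalClosure (H ⊔ M) d).map (QuotientGroup.mk' M) ≤
      H.map (QuotientGroup.mk' M) := by
    rw [map_iterNormalClosure (QuotientGroup.mk'_surjective M), hM,
      ← map_iterNormalClosure (QuotientGroup.mk'_surjective M)]
    exact Subgroup.map_mono h
  rw [Subgroup.map_le_iff_le_comap, Subgroup.comap_map_eq, QuotientGroup.ker_mk'] at h1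
  exact h1

theorem commutator_sup_le (A B M : Subgroup G) [M.Normal] :
    ⁅A ⊔ M, B ⊔ M⁆ ≤ ⁅A, B⁆ ⊔ M := by
  have h : Subgroup.map (QuotientGroup.mk' M) ⁅A ⊔ M, B ⊔ M⁆ ≤
      Subgroup.map (QuotientGroup.mk' M) ⁅A, B⁆ := by
    simp [Subgroup.map_commutator, Subgroup.map_sup, QuotientGroup.map_mk'_self]
  rwa [Subgroup.map_le_iff_le_comap, Subgroup.comap_map_eq, QuotientGroup.ker_mk'] at h

theorem mk_eq_of_mem_sup {H M : Subgroup G} [M.Normal] {x : G} (hx : x ∈ H ⊔ M) :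
    ∃ h ∈ H, (h : G ⧸ M) = x := by
  obtain ⟨h, hh, m, hm, rfl⟩ := Subgroup.mem_sup_of_normal_right.1 hx
  exact ⟨h, hh, QuotientGroup.eq.2 (by simpa using hm)⟩

theorem mem_sup_of_mk_eq {H M : Subgroup G} {x h : G} (hh : h ∈ H)
    (hx : (h : G ⧸ M) = x) : x ∈ H ⊔ M := by
  have := mul_mem (le_sup_left (a := H) (b := M) hh) (le_sup_right (a := H) (QuotientGroup.eq.1 hx))
  simpa using this

theorem conj_mem_sup {H L M : Subgroup G} [M.Normal]
    (h : ∀ h ∈ H, ∀ l ∈ L, h * l * h⁻¹ ∈ L) : ∀ h ∈ H ⊔ M, ∀ l ∈ L ⊔ M, h * l * h⁻¹ ∈ L ⊔ M := by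
  intro x hx y hy
  obtain ⟨a, ha, hax⟩ := mk_eq_of_mem_sup hx
  obtain ⟨b, hb, hby⟩ := mk_eq_of_mem_sup hy
  refine mem_sup_of_mk_eq (h a ha b hb) ?_
  simp only [QuotientGroup.mk_mul, QuotientGroup.mk_inv, hax, hby]

theorem comap_map_mk {N H : Subgroup G} [N.Normal] (h : N ≤ H) :
    (H.map (QuotientGroup.mk' N)).comap (QuotientGroup.mk' N) = H := by
  rw [Subgroup.comap_map_eq, QuotientGroup.ker_mk', sup_eq_left.2 h]

theorem map_comap_mk {N : Subgroup G} [N.Normal] (Q : Subgroup (G ⧸ N)) :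
    (Q.comap (QuotientGroup.mk' N)).map (QuotientGroup.mk' N) = Q :=
  Subgroup.map_comap_eq_self_of_surjective (QuotientGroup.mk'_surjective N) Q

theorem le_comap_mk {N : Subgroup G} [N.Normal] (Q : Subgroup (G ⧸ N)) :
    N ≤ Q.comap (QuotientGroup.mk' N) := by
  simpa using Subgroup.ker_le_comap (f := QuotientGroup.mk' N) Q

theorem comap_mk_le_iff {N : Subgroup G} [N.Normal] {Q R : Subgroup (G ⧸ N)} :
    Q.comap (QuotientGroup.mk' N) ≤ R.comap (QuotientGroup.mk' N) ↔ Q ≤ R :=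
  Subgroup.comap_le_comap_of_surjective (QuotientGroup.mk'_surjective N)

theorem comap_mk_bot {N : Subgroup G} [N.Normal] :
    (⊥ : Subgroup (G ⧸ N)).comap (QuotientGroup.mk' N) = N := by
  rw [MonoidHom.comap_bot, QuotientGroup.ker_mk']

theorem comap_mk_commutator {N : Subgroup G} [N.Normal] (Q R : Subgroup (G ⧸ N)) :
    ⁅Q, R⁆.comap (QuotientGroup.mk' N) =
      ⁅Q.comap (QuotientGroup.mk' N), R.comap (QuotientGroup.mk' N)⁆ ⊔ N := by
  conv_lhs => rw [← map_comap_mk Q, ← map_comap_mk R, ← Subgroup.map_commutator]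
  rw [Subgroup.comap_map_eq, QuotientGroup.ker_mk']

end Subnormal

/-! ### Closed subgroups as intersections of open ones. -/

section Closed

variable {G : Type*} [Group G] [TopologicalSpace G]

theorem isClosed_comap_mk_iff {N : Subgroup G} [N.Normal] {Q : Subgroup (G ⧸ N)} :
    IsClosed ((Q.comap (QuotientGroup.mk' N) : Subgroup G) : Set G) ↔ IsClosed (Q : Set (G ⧸ N)) :=
  (QuotientGroup.isQuotientMap_mk N).isClosed_preimage

variable [IsTopologicalGroup G]

theorem isClosed_sup_of_isOpen (H : Subgroup G) {M : Subgroup G} (hM : IsOpen (M : Set G)) :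
    IsClosed ((H ⊔ M : Subgroup G) : Set G) :=
  Subgroup.isClosed_of_isOpen _ (Subgroup.isOpen_mono le_sup_right hM)

variable [CompactSpace G]

/-- Such a subgroup is determined by its image in the finite coset space `G ⧸ M`. This supplies the
finiteness for the inverse limit. -/
theorem finite_subgroups_ge {M : Subgroup G} (hM : IsOpen (M : Set G)) :
    {H : Subgroup G | M ≤ H}.Finite := by
  have : Finite (G ⧸ M) := Subgroup.quotient_finite_of_isOpen M hM
  refine Set.Finite.of_injOn (f := fun H : Subgroup G => (QuotientGroup.mk '' (H : Set G) : Set (G ⧸ M)))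
    (t := Set.univ) (fun _ _ => Set.mem_univ _) ?_ Set.finite_univ
  have key : ∀ H K : Subgroup G, M ≤ K →
      (QuotientGroup.mk '' (H : Set G) : Set (G ⧸ M)) = QuotientGroup.mk '' (K : Set G) → H ≤ K := by
    intro H K hK h x hx
    have : (QuotientGroup.mk x : G ⧸ M) ∈ (QuotientGroup.mk '' (K : Set G) : Set (G ⧸ M)) :=
      h ▸ ⟨x, hx, rfl⟩
    obtain ⟨y, hy, hyx⟩ := this
    have := mul_mem hy (hK (QuotientGroup.eq.1 hyx))
    simpa using this
  intro H hH K hK h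
  exact le_antisymm (key H K hK h) (key K H hH h.symm)

variable [TotallyDisconnectedSpace G]

/-- The open normal subgroups containing a closed normal subgroup form a basis of its
neighbourhoods. -/
theorem exists_isOpen_normal_ge {N : Subgroup G} [N.Normal] (hN : IsClosed (N : Set G))
    {O : Set G} (hO : IsOpen O) (hNO : (N : Set G) ⊆ O) :
    ∃ M : Subgroup G, M.Normal ∧ IsOpen (M : Set G) ∧ N ≤ M ∧ (M : Set G) ⊆ O := by
  obtain ⟨V, hV, hVO⟩ := compact_open_separated_mul_right hN.isCompact hO hNO
  obtain ⟨W, hWV, hW, h1⟩ := mem_nhds_iff.1 hV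
  obtain ⟨U, hU⟩ := ProfiniteGrp.exist_openNormalSubgroup_sub_open_nhds_of_one hW h1
  refine ⟨N ⊔ U, inferInstance, Subgroup.isOpen_mono le_sup_right U.isOpen, le_sup_left, ?_⟩
  rw [Subgroup.mul_normal]
  exact (Set.mul_subset_mul_left (hU.trans hWV)).trans hVO

/-- A closed subgroup `H` containing `N` is the intersection of the subgroups `H ⊔ M`, where `M`
ranges over the open normal subgroups between `N` and `N₀`. -/
theorem mem_of_forall_mem_sup {N H : Subgroup G} [N.Normal] (hN : IsClosed (N : Set G))
    (hH : IsClosed (H : Set G)) (hNH : N ≤ H) {N₀ : Subgroup G} (hN₀ : IsOpen (N₀ : Set G))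
    (hNN₀ : N ≤ N₀) {x : G}
    (hx : ∀ M : Subgroup G, M.Normal → IsOpen (M : Set G) → N ≤ M → M ≤ N₀ → x ∈ H ⊔ M) :
    x ∈ H := by
  by_contra hxH
  -- An element `m` of this open set has `x * m⁻¹ ∉ H`, so `x = h * m` with `h ∈ H` is impossible.
  have hO : IsOpen (((fun y => x * y⁻¹) ⁻¹' (H : Set G)ᶜ) ∩ (N₀ : Set G)) :=
    (hH.isOpen_compl.preimage (by fun_prop)).inter hN₀
  obtain ⟨M, hM, hMo, hNM, hMO⟩ := exists_isOpen_normal_ge hN hO (by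
    intro y hy
    refine ⟨fun h => hxH ?_, hNN₀ hy⟩
    simpa using mul_mem h (hNH hy))
  obtain ⟨h, hh, m, hm, rfl⟩ := Subgroup.mem_sup_of_normal_right.1
    (hx M hM hMo hNM (fun y hy => (hMO hy).2))
  exact (hMO hm).1 (by simpa using hh)

end Closed

/-! ### Pro-`p` subgroups and components relative to a subgroup. -/

variable {G : Type*} [Group G] [TopologicalSpace G] [IsTopologicalGroup G]

/-- `H / M` is a closed normal pro-`p` subgroup of `G / M` for some prime `p`. -/
structure IsCoreMod (M H : Subgroup G) : Prop where
  le : M ≤ H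
  isClosed : IsClosed (H : Set G)
  normal : H.Normal
  exists_pow_mem : ∃ p : ℕ, p.Prime ∧ ∀ x ∈ H, ∀ U : Subgroup G, U.Normal → IsOpen (U : Set G) →
    M ≤ U → ∃ k : ℕ, x ^ p ^ k ∈ U

/-- `H / M` is a component of subnormal depth at most `d` in `G / M`. -/
structure IsComponentMod (d : ℕ) (M H : Subgroup G) : Prop where
  le : M ≤ H
  isClosed : IsClosed (H : Set G)
  subnormal : iterNormalClosure H d ≤ H
  not_le : ¬ H ≤ M
  perfect : H ≤ (⁅H, H⁆ ⊔ M).topologicalClosure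
  eq_or_commutator_le : ∀ L : Subgroup G, IsClosed (L : Set G) → M ≤ L → L ≤ H →
    (∀ h ∈ H, ∀ l ∈ L, h * l * h⁻¹ ∈ L) → L = H ∨ ⁅L, H⁆ ≤ M

theorem IsCoreMod.sup {M M' H : Subgroup G} [M'.Normal] (hM' : IsOpen (M' : Set G))
    (hMM' : M ≤ M') (h : IsCoreMod M H) : IsCoreMod M' (H ⊔ M') := by
  obtain ⟨p, hp, hpow⟩ := h.exists_pow_mem
  have := h.normal
  refine ⟨le_sup_right, isClosed_sup_of_isOpen _ hM', inferInstance, p, hp, ?_⟩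
  intro x hx U hU hUo hMU
  obtain ⟨a, ha, hax⟩ := mk_eq_of_mem_sup (sup_le_sup_left hMU H hx)
  obtain ⟨k, hk⟩ := hpow a ha U hU hUo (hMM'.trans hMU)
  refine ⟨k, ?_⟩
  rwa [← QuotientGroup.eq_one_iff, QuotientGroup.mk_pow, hax, ← QuotientGroup.mk_pow,
    QuotientGroup.eq_one_iff] at hk

/-- A nontrivial image of a component is a component. The condition `¬ H ≤ M'` is what keeps the
image nontrivial. -/
theorem IsComponentMod.sup {d : ℕ} {M M' H : Subgroup G} [M'.Normal] (hM' : IsOpen (M' : Set G))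
    (hMM' : M ≤ M') (h : IsComponentMod d M H) (hH : ¬ H ≤ M') :
    IsComponentMod d M' (H ⊔ M') := by
  refine ⟨le_sup_right, isClosed_sup_of_isOpen _ hM', iterNormalClosure_sup_le h.subnormal,
    fun h' => hH (le_sup_left.trans h'), ?_, ?_⟩
  · refine sup_le (h.perfect.trans (Subgroup.topologicalClosure_mono (sup_le_sup ?_ hMM')))
      (le_sup_right.trans (Subgroup.le_topologicalClosure _))
    exact Subgroup.commutator_mono le_sup_left le_sup_left
  · intro L hL hML hLH hconj
    rcases h.eq_or_commutator_le (L ⊓ H) (hL.inter h.isClosed) (le_inf (hMM'.trans hML) h.le)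
      inf_le_right (fun a ha l hl => ⟨hconj a (le_sup_left (a := H) ha) l hl.1,
        H.mul_mem (H.mul_mem ha hl.2) (H.inv_mem ha)⟩) with h1 | h1
    · exact Or.inl (hLH.antisymm (sup_le (inf_eq_right.1 h1) hML))
    · right
      -- Dedekind's modular law, from `M' ≤ L ≤ H ⊔ M'`.
      have hL' : L ≤ (L ⊓ H) ⊔ M' := by
        intro x hx
        obtain ⟨a, ha, m, hm, rfl⟩ := Subgroup.mem_sup_of_normal_right.1 (hLH hx)
        have haL : a ∈ L := by simpa using mul_mem hx (inv_mem (hML hm))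
        exact mul_mem (le_sup_left (a := L ⊓ H) ⟨haL, ha⟩) (le_sup_right (a := L ⊓ H) hm)
      exact (Subgroup.commutator_mono hL' le_rfl).trans
        ((commutator_sup_le _ _ _).trans (sup_le (h1.trans hMM') le_rfl))

/-! ### Compactness: limits of subgroups of finite quotients. -/

variable [CompactSpace G]

/-- An inverse system of nonempty families of subgroups, one for each open normal subgroup between
`K` and `N₀`, has a limit. -/
theorem exists_limit_subgroup (K N₀ : Subgroup G) [N₀.Normal] (hN₀ : IsOpen (N₀ : Set G))
    (hKN₀ : K ≤ N₀) (P : Subgroup G → Subgroup G → Prop) (hle : ∀ M H, P M H → M ≤ H)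
    (hpush : ∀ M M' H : Subgroup G, M'.Normal → IsOpen (M' : Set G) → M ≤ M' → M' ≤ N₀ →
      ¬ H ≤ N₀ → P M H → P M' (H ⊔ M'))
    (hex : ∀ M : Subgroup G, M.Normal → IsOpen (M : Set G) → K ≤ M → M ≤ N₀ →
      ∃ H, P M H ∧ ¬ H ≤ N₀) :
    ∃ Q : Subgroup G, IsClosed (Q : Set G) ∧ K ≤ Q ∧ ¬ Q ≤ N₀ ∧
      (∀ x, (∀ M : Subgroup G, M.Normal → IsOpen (M : Set G) → K ≤ M → M ≤ N₀ → x ∈ Q ⊔ M) →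
        x ∈ Q) ∧
      ∀ M : Subgroup G, M.Normal → IsOpen (M : Set G) → K ≤ M → M ≤ N₀ → P M (Q ⊔ M) := by
  let J := {M : Subgroup G // M.Normal ∧ IsOpen (M : Set G) ∧ K ≤ M ∧ M ≤ N₀}
  let inter : J → J → J := fun A B => ⟨A.1 ⊓ B.1, by
    have := A.2.1
    have := B.2.1
    infer_instance, A.2.2.1.inter B.2.2.1,
    le_inf A.2.2.2.1 B.2.2.2.1, inf_le_left.trans A.2.2.2.2⟩
  have inter_left : ∀ A B : J, inter A B ≤ A := fun A B => inf_le_left (a := A.1)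
  have inter_right : ∀ A B : J, inter A B ≤ B := fun A B => inf_le_right (a := A.1)
  have : IsDirectedOrder Jᵒᵈ := ⟨fun A B => ⟨OrderDual.toDual (inter A.ofDual B.ofDual),
    inter_left _ _, inter_right _ _⟩⟩
  -- The transition map from level `A` to a larger `B` is `H ↦ H ⊔ B`. Not lying in `N₀` is
  -- preserved, so the limit is nontrivial.
  let F : (Jᵒᵈ)ᵒᵖ ⥤ Type _ :=
    { obj := fun A => {H : Subgroup G // P A.unop.ofDual.1 H ∧ ¬ H ≤ N₀}
      map := fun {A B} f => ↾(fun H => ⟨H.1 ⊔ B.unop.ofDual.1,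
        hpush _ _ _ B.unop.ofDual.2.1 B.unop.ofDual.2.2.1 (CategoryTheory.leOfHom f.unop)
          B.unop.ofDual.2.2.2.2 H.2.2 H.2.1, fun h => H.2.2 (le_sup_left.trans h)⟩)
      map_id := by
        intro A
        refine ConcreteCategory.hom_ext _ _ fun H => ?_
        exact Subtype.ext (sup_eq_left.2 (hle _ _ H.2.1))
      map_comp := by
        intro A B C f g
        refine ConcreteCategory.hom_ext _ _ fun H => Subtype.ext ?_
        have : B.unop.ofDual.1 ≤ C.unop.ofDual.1 := CategoryTheory.leOfHom g.unop
        change H.1 ⊔ C.unop.ofDual.1 = H.1 ⊔ B.unop.ofDual.1 ⊔ C.unop.ofDual.1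
        rw [sup_assoc, sup_eq_right.2 this] }
  have hfin : ∀ A, Finite (F.obj A) := fun A =>
    Set.Finite.subset (finite_subgroups_ge A.unop.ofDual.2.2.1) fun H hH => hle _ _ hH.1
  have hne : ∀ A, Nonempty (F.obj A) := fun A => by
    obtain ⟨h1, h2, h3, h4⟩ := A.unop.ofDual.2
    obtain ⟨H, hH⟩ := hex _ h1 h2 h3 h4
    exact ⟨⟨H, hH⟩⟩
  obtain ⟨s, hs⟩ := nonempty_sections_of_finite_inverse_system F
  let S : J → Subgroup G := fun A => (s (Opposite.op (OrderDual.toDual A))).1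
  have hP : ∀ A : J, P A.1 (S A) ∧ ¬ S A ≤ N₀ := fun A => (s (Opposite.op (OrderDual.toDual A))).2
  have hS : ∀ A B : J, A ≤ B → S A ⊔ B.1 = S B := by
    intro A B hAB
    have h1 : OrderDual.toDual B ≤ OrderDual.toDual A := hAB
    have := hs (CategoryTheory.homOfLE h1).op
    exact congrArg Subtype.val this
  have hSmono : ∀ A B : J, A ≤ B → S A ≤ S B := fun A B h => le_sup_left.trans (hS A B h).le
  have hSle : ∀ A : J, A.1 ≤ S A := fun A => hle _ _ (hP A).1
  have hSclosed : ∀ A : J, IsClosed (S A : Set G) := fun A =>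
    Subgroup.isClosed_of_isOpen _ (Subgroup.isOpen_mono (hSle A) A.2.2.1)
  -- The intersection still surjects onto each level: for `y ∈ S A` the sets `S B ∩ yA` are compact,
  -- nonempty and directed, so they have a common point.
  have hQS : ∀ A : J, (⨅ B, S B) ⊔ A.1 = S A := by
    intro A
    refine le_antisymm (sup_le (iInf_le _ _) (hSle A)) fun y hy => ?_
    have := A.2.1
    have hAc : IsClosed ((fun z => z⁻¹ * y) ⁻¹' (A.1 : Set G)) :=
      (Subgroup.isClosed_of_isOpen _ A.2.2.1).preimage (by fun_prop)
    have hc : ∀ B : J, IsClosed ((S B : Set G) ∩ ((fun z => z⁻¹ * y) ⁻¹' (A.1 : Set G))) :=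
      fun B => (hSclosed B).inter hAc
    have : Nonempty J := ⟨A⟩
    obtain ⟨z, hz⟩ := IsCompact.nonempty_iInter_of_directed_nonempty_isCompact_isClosed
      (fun B : J => (S B : Set G) ∩ ((fun z => z⁻¹ * y) ⁻¹' (A.1 : Set G)))
      (fun B C => ⟨inter B C, Set.inter_subset_inter_left _ (hSmono _ _ (inter_left B C)),
        Set.inter_subset_inter_left _ (hSmono _ _ (inter_right B C))⟩)
      (fun B => by
        rw [← hS _ _ (inter_right B A)] at hy
        obtain ⟨a, ha, m, hm, rfl⟩ := Subgroup.mem_sup_of_normal_right.1 hy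
        exact ⟨a, hSmono _ _ (inter_left B A) ha, by simpa using hm⟩)
      (fun B => (hc B).isCompact) hc
    rw [Set.mem_iInter] at hz
    have := mul_mem (le_sup_left (b := A.1) (Subgroup.mem_iInf.2 fun B => (hz B).1))
      (le_sup_right (a := ⨅ B, S B) (hz A).2)
    simpa using this
  refine ⟨⨅ B, S B, ?_, le_iInf fun B => B.2.2.2.1.trans (hSle B), ?_, ?_, ?_⟩
  · rw [Subgroup.coe_iInf]
    exact isClosed_iInter hSclosed
  · intro h
    apply (hP ⟨N₀, inferInstance, hN₀, hKN₀, le_rfl⟩).2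
    rw [← hQS]
    exact sup_le h le_rfl
  · intro x hx
    rw [Subgroup.mem_iInf]
    intro B
    rw [← hQS]
    exact hx _ B.2.1 B.2.2.1 B.2.2.2.1 B.2.2.2.2
  · intro M h1 h2 h3 h4
    have := hQS ⟨M, h1, h2, h3, h4⟩
    rw [this]
    exact (hP ⟨M, h1, h2, h3, h4⟩).1

theorem exists_isOpen_forall_isCoreMod_le {K N₀ : Subgroup G} [N₀.Normal]
    (hN₀ : IsOpen (N₀ : Set G)) (hKN₀ : K ≤ N₀)
    (hdeg : ∀ H, IsCoreMod K H → H ≤ K) :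
    ∃ M : Subgroup G, M.Normal ∧ IsOpen (M : Set G) ∧ K ≤ M ∧ M ≤ N₀ ∧
      ∀ H, IsCoreMod M H → H ≤ N₀ := by
  by_contra! hcon
  obtain ⟨Q, hQc, hKQ, hQN₀, hmem, hQ⟩ := exists_limit_subgroup K N₀ hN₀ hKN₀ IsCoreMod
    (fun _ _ h => h.le) (fun M M' H hM' hMo hMM' _ _ h => h.sup hMo hMM') hcon
  refine hQN₀ ((hdeg Q ⟨hKQ, hQc, ⟨fun x hx g => hmem _ fun M h1 h2 h3 h4 => ?_⟩, ?_⟩).trans hKN₀)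
  · exact (hQ M h1 h2 h3 h4).normal.conj_mem _ (Subgroup.mem_sup_left hx) g
  obtain ⟨p, hp, hpow⟩ := (hQ N₀ inferInstance hN₀ hKN₀ le_rfl).exists_pow_mem
  refine ⟨p, hp, fun x hx U hU hUo hKU => ?_⟩
  obtain ⟨q, hq, hqow⟩ := (hQ (U ⊓ N₀) inferInstance (hUo.inter hN₀) (le_inf hKU hKN₀)
    inf_le_right).exists_pow_mem
  obtain ⟨y, hyQ, hyN⟩ := SetLike.not_le_iff_exists.1 hQN₀
  -- The prime could vary with the level. But `y` has nontrivial image in `G ⧸ N₀`, whose order is a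
  -- power of both `p` and `q`.
  have hpq : p = q := by
    by_contra hne
    obtain ⟨k, hk⟩ := hpow y (Subgroup.mem_sup_left hyQ) N₀ inferInstance hN₀ le_rfl
    obtain ⟨l, hl⟩ := hqow y (Subgroup.mem_sup_left hyQ) N₀ inferInstance hN₀ inf_le_right
    rw [← QuotientGroup.eq_one_iff, QuotientGroup.mk_pow] at hk hl
    have h1 := Nat.eq_one_of_dvd_coprimes
      (Nat.Coprime.pow k l ((Nat.coprime_primes hp hq).2 hne))
      (orderOf_dvd_of_pow_eq_one hk) (orderOf_dvd_of_pow_eq_one hl)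
    rw [orderOf_eq_one_iff, QuotientGroup.eq_one_iff] at h1
    exact hyN h1
  subst hpq
  exact hqow x (Subgroup.mem_sup_left hx) U hU hUo inf_le_left

theorem exists_isOpen_forall_isComponentMod_le [TotallyDisconnectedSpace G] (d : ℕ)
    {K N₀ : Subgroup G} [K.Normal] [N₀.Normal] (hK : IsClosed (K : Set G)) (hN₀ : IsOpen (N₀ : Set G)) (hKN₀ : K ≤ N₀)
    (hdeg : ∀ H, ¬ IsComponentMod d K H) :
    ∃ M : Subgroup G, M.Normal ∧ IsOpen (M : Set G) ∧ K ≤ M ∧ M ≤ N₀ ∧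
      ∀ H, IsComponentMod d M H → H ≤ N₀ := by
  by_contra! hcon
  obtain ⟨Q, hQc, hKQ, hQN₀, hmem, hQ⟩ := exists_limit_subgroup K N₀ hN₀ hKN₀ (IsComponentMod d)
    (fun _ _ h => h.le)
    (fun M M' H hM' hMo hMM' hN hH h => h.sup hMo hMM' fun h' => hH (h'.trans hN)) hcon
  refine hdeg Q ⟨hKQ, hQc, ?_, fun h => hQN₀ (h.trans hKN₀), ?_, ?_⟩
  · intro x hx
    exact hmem x fun M h1 h2 h3 h4 =>
      (hQ M h1 h2 h3 h4).subnormal (iterNormalClosure_mono le_sup_left d hx)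
  · intro x hx
    refine mem_of_forall_mem_sup hK (Subgroup.isClosed_topologicalClosure _)
      (le_sup_right.trans (Subgroup.le_topologicalClosure _)) hN₀ hKN₀ fun M h1 h2 h3 h4 => ?_
    have h5 := (hQ M h1 h2 h3 h4).perfect (Subgroup.mem_sup_left hx)
    have h6 : (⁅Q ⊔ M, Q ⊔ M⁆ ⊔ M).topologicalClosure ≤ ⁅Q ⊔ M, Q ⊔ M⁆ ⊔ M :=
      Subgroup.topologicalClosure_minimal _ le_rfl (isClosed_sup_of_isOpen _ h2)
    refine (sup_le ((commutator_sup_le _ _ _).trans (sup_le_sup_right ?_ _)) le_sup_right :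
      ⁅Q ⊔ M, Q ⊔ M⁆ ⊔ M ≤ _) (h6 h5)
    exact le_sup_left.trans (Subgroup.le_topologicalClosure _)
  · intro L hL hKL hLQ hconj
    by_contra! hcon
    obtain ⟨hne, hcomm⟩ := hcon
    obtain ⟨x, hxQ, hxL⟩ := SetLike.not_le_iff_exists.1 fun h => hne (hLQ.antisymm h)
    -- Properness of `L` in `Q` is already visible at some level `M₀`. Below `M₀` only the
    -- commutator alternative remains, so `⁅L, Q⁆` lies in every `M`, hence in `K`.
    have : ∃ M : Subgroup G, M.Normal ∧ IsOpen (M : Set G) ∧ K ≤ M ∧ M ≤ N₀ ∧ x ∉ L ⊔ M := by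
      by_contra! h
      exact hxL (mem_of_forall_mem_sup hK hL hKL hN₀ hKN₀ h)
    obtain ⟨M₀, h1, h2, h3, h4, h5⟩ := this
    refine hcomm fun y hy => mem_of_forall_mem_sup hK hK le_rfl hN₀ hKN₀ fun M g1 g2 g3 g4 => ?_
    have hM : (M ⊓ M₀).Normal := inferInstance
    have hMo : IsOpen ((M ⊓ M₀ : Subgroup G) : Set G) := g2.inter h2
    rcases (hQ (M ⊓ M₀) hM hMo (le_inf g3 h3) (inf_le_left.trans g4)).eq_or_commutator_le
      (L ⊔ (M ⊓ M₀)) (isClosed_sup_of_isOpen _ hMo) le_sup_right (sup_le_sup_right hLQ _)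
      (conj_mem_sup hconj) with h | h
    · have hx : x ∈ L ⊔ (M ⊓ M₀) := h ▸ Subgroup.mem_sup_left hxQ
      exact absurd (sup_le_sup_left inf_le_right L hx) h5
    · exact Subgroup.mem_sup_right
        ((h (Subgroup.commutator_mono le_sup_left le_sup_left hy)).1)

/-! ### Quasisimple groups and components without central quotients. -/

section Quasisimple

/-- If `LZ = Q` with `Z` the centre, then central factors drop out of commutators, so `L` contains
the derived group and, being closed, all of `Q`. Conversely, a nontrivial perfect group is not
abelian, so `Q/Z` is nontrivial. -/
theorem isQuasisimple_iff (Q : Type*) [Group Q] [TopologicalSpace Q] [IsTopologicalGroup Q]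
    [CompactSpace Q] [T2Space Q] :
    IsQuasisimple Q ↔ IsPerfect Q ∧ Nontrivial Q ∧ ∀ L : Subgroup Q, IsClosed (L : Set Q) →
      L.Normal → L = ⊤ ∨ L ≤ Subgroup.center Q := by
  have hZ : IsClosed (Subgroup.center Q : Set Q) := by
    rw [← Subgroup.centralizer_univ]
    exact Set.isClosed_centralizer _
  constructor
  · rintro ⟨hperf, hnt, hsimp⟩
    refine ⟨hperf, (QuotientGroup.mk_surjective (s := Subgroup.center Q)).nontrivial,
      fun L hL hLn => ?_⟩
    rcases hsimp (L.map (QuotientGroup.mk' _))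
      (QuotientGroup.isClosedMap_coe hZ.isCompact _ hL)
      (hLn.map _ (QuotientGroup.mk'_surjective _)) with h | h
    · right
      rwa [Subgroup.map_eq_bot_iff, QuotientGroup.ker_mk'] at h
    · left
      have h1 : L ⊔ Subgroup.center Q = ⊤ := by
        have := congrArg (Subgroup.comap (QuotientGroup.mk' _)) h
        rwa [Subgroup.comap_map_eq, QuotientGroup.ker_mk', Subgroup.comap_top] at this
      have h2 : commutator Q ≤ L := by
        rw [commutator_def, ← h1, Subgroup.commutator_le]
        intro x hx y hy
        obtain ⟨a, ha, z, hz, rfl⟩ := Subgroup.mem_sup_of_normal_right.1 hx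
        obtain ⟨b, hb, w, hw, rfl⟩ := Subgroup.mem_sup_of_normal_right.1 hy
        have e : a * z * (b * w) * (a * z)⁻¹ * (b * w)⁻¹ = a * b * a⁻¹ * b⁻¹ := by
          have hz' := Subgroup.mem_center_iff.1 hz
          have hw' := Subgroup.mem_center_iff.1 hw
          calc a * z * (b * w) * (a * z)⁻¹ * (b * w)⁻¹
              = a * (z * b) * (w * z⁻¹) * a⁻¹ * w⁻¹ * b⁻¹ := by group
            _ = a * b * (a⁻¹ * w) * w⁻¹ * b⁻¹ := by
                rw [← hz' b, ← hw' z⁻¹, hw' a⁻¹]; group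
            _ = a * b * a⁻¹ * b⁻¹ := by group
        rw [commutatorElement_def, e]
        exact L.mul_mem (L.mul_mem (L.mul_mem ha hb) (L.inv_mem ha)) (L.inv_mem hb)
      exact top_le_iff.1 (hperf.ge.trans (Subgroup.topologicalClosure_minimal _ h2 hL))
  · rintro ⟨hperf, hnt, hsimp⟩
    refine ⟨hperf, ?_, fun L hL hLn => ?_⟩
    · rw [← not_subsingleton_iff_nontrivial]
      intro hsub
      have h : Subgroup.center Q = ⊤ := QuotientGroup.subgroup_eq_top_of_subsingleton _ hsub
      have h1 : commutator Q = ⊥ := by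
        rw [commutator_def, Subgroup.commutator_eq_bot_iff_le_centralizer,
          Subgroup.coe_top, Subgroup.centralizer_univ, h]
      have h2 : (⊥ : Subgroup Q).topologicalClosure = ⊥ :=
        le_bot_iff.1 (Subgroup.topologicalClosure_minimal _ le_rfl (by simp))
      have h3 : (⊤ : Subgroup Q) = ⊥ := by
        rw [← hperf, h1, h2]
      exact bot_ne_top h3.symm
    · have hL' : IsClosed ((L.comap (QuotientGroup.mk' (Subgroup.center Q)) : Subgroup Q) : Set Q) :=
        hL.preimage QuotientGroup.continuous_mk
      rcases hsimp _ hL' (hLn.comap _) with h | h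
      · right
        rw [← Subgroup.map_comap_eq_self_of_surjective (QuotientGroup.mk'_surjective _) L, h,
          Subgroup.map_top_of_surjective _ (QuotientGroup.mk'_surjective _)]
      · left
        rw [← Subgroup.map_comap_eq_self_of_surjective (QuotientGroup.mk'_surjective _) L,
          Subgroup.map_eq_bot_iff, QuotientGroup.ker_mk']
        exact h

variable {G : Type*} [Group G] [TopologicalSpace G] [IsTopologicalGroup G]

theorem isPerfect_subgroup_iff {Q : Subgroup G} :
    IsPerfect Q ↔ Q ≤ ⁅Q, Q⁆.topologicalClosure := by
  have hmap : (commutator Q).map Q.subtype = ⁅Q, Q⁆ := by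
    rw [commutator_def, Subgroup.map_commutator, ← MonoidHom.range_eq_map, Subgroup.range_subtype]
  have key : ∀ x : Q, x ∈ (commutator Q).topologicalClosure ↔ (x : G) ∈ ⁅Q, Q⁆.topologicalClosure := by
    intro x
    rw [← hmap]
    exact closure_subtype
  rw [IsPerfect, eq_top_iff]
  constructor
  · intro h x hx
    exact (key ⟨x, hx⟩).1 (h trivial)
  · intro h x _
    exact (key x).2 (h x.2)

theorem isComponent_iff [CompactSpace G] [T2Space G] {Q : Subgroup G} :
    IsComponent Q ↔ ∃ d, IsComponentMod d ⊥ Q := by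
  suffices h : IsClosed (Q : Set G) → (IsQuasisimple Q ↔ ¬ Q ≤ ⊥ ∧
      Q ≤ (⁅Q, Q⁆ ⊔ ⊥).topologicalClosure ∧ ∀ L : Subgroup G, IsClosed (L : Set G) → ⊥ ≤ L →
      L ≤ Q → (∀ h ∈ Q, ∀ l ∈ L, h * l * h⁻¹ ∈ L) → L = Q ∨ ⁅L, Q⁆ ≤ ⊥) by
    constructor
    · rintro ⟨h1, h2, h3⟩
      obtain ⟨d, hd⟩ := (isSubnormal_iff_iterNormalClosure_le Q).1 h2
      obtain ⟨h4, h5, h6⟩ := (h h1).1 h3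
      exact ⟨d, bot_le, h1, hd, h4, h5, h6⟩
    · rintro ⟨d, -, h1, hd, h4, h5, h6⟩
      exact ⟨h1, (isSubnormal_iff_iterNormalClosure_le Q).2 ⟨d, hd⟩, (h h1).2 ⟨h4, h5, h6⟩⟩
  intro hQ
  have : CompactSpace Q := isCompact_iff_compactSpace.1 hQ.isCompact
  have hcenter : ∀ L : Subgroup G, L ≤ Q →
      (L.subgroupOf Q ≤ Subgroup.center Q ↔ ⁅L, Q⁆ ≤ ⊥) := by
    intro L hL
    rw [le_bot_iff, Subgroup.commutator_eq_bot_iff_le_centralizer]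
    constructor
    · intro h x hx
      rw [Subgroup.mem_centralizer_iff]
      intro y hy
      exact congrArg Subtype.val (Subgroup.mem_center_iff.1 (h (x := ⟨x, hL hx⟩) hx) ⟨y, hy⟩)
    · intro h x hx
      rw [Subgroup.mem_center_iff]
      intro y
      exact Subtype.ext (Subgroup.mem_centralizer_iff.1 (h hx) y y.2)
  rw [isQuasisimple_iff, isPerfect_subgroup_iff, le_bot_iff, sup_bot_eq,
    Subgroup.nontrivial_iff_ne_bot]
  constructor
  · rintro ⟨h1, h2, h3⟩
    refine ⟨h2, h1, fun L hL _ hLQ hconj => ?_⟩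
    rcases h3 (L.subgroupOf Q) (hL.preimage continuous_subtype_val)
      ⟨fun x hx y => hconj y y.2 x hx⟩ with h | h
    · exact Or.inl (hLQ.antisymm (Subgroup.subgroupOf_eq_top.1 h))
    · exact Or.inr ((hcenter L hLQ).1 h)
  · rintro ⟨h1, h2, h3⟩
    refine ⟨h2, h1, fun L hL hLn => ?_⟩
    have hLQ : L.map Q.subtype ≤ Q := Subgroup.map_subtype_le L
    have hLL : (L.map Q.subtype).subgroupOf Q = L :=
      Subgroup.comap_map_eq_self_of_injective Q.subtype_injective L
    rcases h3 (L.map Q.subtype) (hQ.isClosedEmbedding_subtypeVal.isClosedMap _ hL) bot_le hLQ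
      (by
        rintro h hh _ ⟨l, hl, rfl⟩
        exact ⟨⟨h, hh⟩ * l * ⟨h, hh⟩⁻¹, hLn.conj_mem l hl _, rfl⟩) with h | h
    · left
      rw [← hLL, h, Subgroup.subgroupOf_self]
    · right
      rw [← hLL]
      exact (hcenter _ hLQ).2 h

end Quasisimple

/-! ### Fitting-degeneracy of a quotient, read inside `G`. -/

section Quotient

variable {G : Type*} [Group G] [TopologicalSpace G] [IsTopologicalGroup G]

/-- The quotient map is open and continuous. -/
theorem comap_mk_topologicalClosure {N : Subgroup G} [N.Normal] (Q : Subgroup (G ⧸ N)) :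
    Q.topologicalClosure.comap (QuotientGroup.mk' N) =
      (Q.comap (QuotientGroup.mk' N)).topologicalClosure :=
  SetLike.coe_injective (QuotientGroup.isOpenMap_coe.preimage_closure_eq_closure_preimage
    QuotientGroup.continuous_mk _)

theorem isComponentMod_bot_iff {d : ℕ} {N : Subgroup G} [N.Normal] {Q : Subgroup (G ⧸ N)} :
    IsComponentMod d ⊥ Q ↔ IsComponentMod d N (Q.comap (QuotientGroup.mk' N)) := by
  have hsub : iterNormalClosure Q d ≤ Q ↔
      iterNormalClosure (Q.comap (QuotientGroup.mk' N)) d ≤ Q.comap (QuotientGroup.mk' N) := by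
    rw [← Subgroup.map_le_iff_le_comap, map_iterNormalClosure (QuotientGroup.mk'_surjective N),
      map_comap_mk]
  have hle : Q ≤ ⊥ ↔ Q.comap (QuotientGroup.mk' N) ≤ N := by
    rw [← comap_mk_le_iff, comap_mk_bot]
  have hperf : Q ≤ (⁅Q, Q⁆ ⊔ ⊥).topologicalClosure ↔ Q.comap (QuotientGroup.mk' N) ≤
      (⁅Q.comap (QuotientGroup.mk' N), Q.comap (QuotientGroup.mk' N)⁆ ⊔ N).topologicalClosure := by
    rw [← comap_mk_le_iff, comap_mk_topologicalClosure, sup_bot_eq, comap_mk_commutator]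
  have hcomm : ∀ L : Subgroup (G ⧸ N), ⁅L, Q⁆ ≤ ⊥ ↔
      ⁅L.comap (QuotientGroup.mk' N), Q.comap (QuotientGroup.mk' N)⁆ ≤ N := by
    intro L
    rw [← comap_mk_le_iff, comap_mk_bot, comap_mk_commutator, sup_le_iff, and_iff_left le_rfl]
  constructor
  · rintro ⟨-, h1, h2, h3, h4, h5⟩
    refine ⟨le_comap_mk Q, isClosed_comap_mk_iff.2 h1, hsub.1 h2, fun h => h3 (hle.2 h),
      hperf.1 h4, fun L hL hNL hLQ hconj => ?_⟩
    rw [← comap_map_mk hNL] at hL hLQ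
    rcases h5 _ (isClosed_comap_mk_iff.1 hL) bot_le (comap_mk_le_iff.1 hLQ) (by
      rintro h hh _ ⟨l, hl, rfl⟩
      obtain ⟨g, rfl⟩ := QuotientGroup.mk'_surjective N h
      exact ⟨g * l * g⁻¹, hconj g hh l hl, by simp⟩) with h | h
    · left
      rw [← h, comap_map_mk hNL]
    · right
      rw [hcomm, comap_map_mk hNL] at h
      exact h
  · rintro ⟨-, h1, h2, h3, h4, h5⟩
    refine ⟨bot_le, isClosed_comap_mk_iff.1 h1, hsub.2 h2, fun h => h3 (hle.1 h),
      hperf.2 h4, fun L hL _ hLQ hconj => ?_⟩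
    rcases h5 _ (isClosed_comap_mk_iff.2 hL) (le_comap_mk L) (comap_mk_le_iff.2 hLQ) (by
      intro h hh l hl
      simpa using hconj _ hh _ hl) with h | h
    · left
      rw [← map_comap_mk L, h, map_comap_mk]
    · exact Or.inr ((hcomm L).2 h)

theorem isCoreMod_comap_iff [CompactSpace G] [TotallyDisconnectedSpace G] {N : Subgroup G}
    [N.Normal] (hN : IsClosed (N : Set G)) {H : Subgroup (G ⧸ N)} :
    IsCoreMod N (H.comap (QuotientGroup.mk' N)) ↔
      IsClosed (H : Set (G ⧸ N)) ∧ H.Normal ∧ ∃ p : ℕ, p.Prime ∧ IsProP p H := by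
  constructor
  · rintro ⟨-, h1, h2, p, hp, hpow⟩
    refine ⟨isClosed_comap_mk_iff.1 h1, ?_, p, hp, fun U g => ?_⟩
    · rw [← map_comap_mk H]
      exact h2.map _ (QuotientGroup.mk'_surjective N)
    obtain ⟨⟨h, hh⟩, rfl⟩ := QuotientGroup.mk_surjective g
    obtain ⟨x, rfl⟩ := QuotientGroup.mk_surjective h
    obtain ⟨O, hO, hOU⟩ := isOpen_induced_iff.1 U.isOpen
    -- An open normal subgroup `U` of `H` need not come from one of `G`, but the trace on `H` of the
    -- image of a small enough `M` lies in `U`.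
    obtain ⟨M, hM, hMo, hNM, hMO⟩ := exists_isOpen_normal_ge hN
      (hO.preimage (QuotientGroup.continuous_mk (N := N))) (by
        intro y hy
        have : (1 : H) ∈ Subtype.val ⁻¹' O := by
          rw [hOU]
          exact one_mem U
        rw [Set.mem_preimage, (QuotientGroup.eq_one_iff y).2 hy]
        exact this)
    obtain ⟨k, hk⟩ := hpow x hh M hM hMo hNM
    refine ⟨k, ?_⟩
    rw [← QuotientGroup.mk_pow, QuotientGroup.eq_one_iff]
    have : (⟨x, hh⟩ ^ p ^ k : H) ∈ Subtype.val ⁻¹' O := hMO hk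
    rw [hOU] at this
    exact this
  · rintro ⟨h1, h2, p, hp, hpow⟩
    refine ⟨le_comap_mk H, isClosed_comap_mk_iff.2 h1, h2.comap _, p, hp, ?_⟩
    intro x hx U hU hUo hNU
    have hn : ((U.map (QuotientGroup.mk' N)).subgroupOf H).Normal :=
      (hU.map _ (QuotientGroup.mk'_surjective N)).subgroupOf H
    have ho : IsOpen (((U.map (QuotientGroup.mk' N)).subgroupOf H : Subgroup H) : Set H) :=
      (QuotientGroup.isOpenMap_coe _ hUo).preimage continuous_subtype_val
    obtain ⟨k, hk⟩ := hpow ⟨⟨_, ho⟩, hn⟩ (QuotientGroup.mk ⟨x, hx⟩)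
    refine ⟨k, ?_⟩
    rw [← QuotientGroup.mk_pow, QuotientGroup.eq_one_iff] at hk
    rw [← comap_map_mk hNU]
    exact hk

theorem isFittingDegenerate_iff [CompactSpace G] [T2Space G] :
    IsFittingDegenerate G ↔
      (∀ H : Subgroup G, (IsClosed (H : Set G) ∧ H.Normal ∧ ∃ p : ℕ, p.Prime ∧ IsProP p H) →
        H = ⊥) ∧ ∀ Q : Subgroup G, ¬ IsComponent Q := by
  have hbot : (⊥ : Subgroup G).topologicalClosure = ⊥ :=
    le_bot_iff.1 (Subgroup.topologicalClosure_minimal _ le_rfl (by simp))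
  constructor
  · intro h
    have hfit : fitting G = ⊥ := le_bot_iff.1
      ((le_sup_left.trans (Subgroup.le_topologicalClosure _)).trans h.le)
    have hlay : layer G = ⊥ := le_bot_iff.1
      ((le_sup_right.trans (Subgroup.le_topologicalClosure _)).trans h.le)
    refine ⟨?_, fun Q hQ => ?_⟩
    · rintro H ⟨h1, h2, p, hp, h3⟩
      have hcore : H ≤ pCore p G := (le_sSup (show H ∈ {H : Subgroup G |
        IsClosed (H : Set G) ∧ H.Normal ∧ IsProP p H} from ⟨h1, h2, h3⟩)).trans
        (Subgroup.le_topologicalClosure _)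
      have : pCore p G ≤ fitting G := (le_sSup (show pCore p G ∈ {H : Subgroup G |
        ∃ p : ℕ, p.Prime ∧ H = pCore p G} from ⟨p, hp, rfl⟩)).trans
        (Subgroup.le_topologicalClosure _)
      exact le_bot_iff.1 ((hcore.trans this).trans hfit.le)
    · have h1 : Q ≤ layer G := (le_sSup (show Q ∈ {Q : Subgroup G | IsComponent Q} from hQ)).trans
        (Subgroup.le_topologicalClosure _)
      obtain ⟨d, hd⟩ := isComponent_iff.1 hQ
      exact hd.not_le (h1.trans hlay.le)
  · rintro ⟨h1, h2⟩
    have hcore : ∀ p : ℕ, p.Prime → pCore p G = ⊥ := by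
      intro p hp
      rw [pCore, ← hbot]
      congr 1
      rw [sSup_eq_bot]
      exact fun H hH => h1 H ⟨hH.1, hH.2.1, p, hp, hH.2.2⟩
    have hfit : fitting G = ⊥ := by
      rw [fitting, ← hbot]
      congr 1
      rw [sSup_eq_bot]
      rintro H ⟨p, hp, rfl⟩
      exact hcore p hp
    have hlay : layer G = ⊥ := by
      rw [layer, ← hbot]
      congr 1
      rw [sSup_eq_bot]
      exact fun Q hQ => absurd hQ (h2 Q)
    rw [IsFittingDegenerate, genFitting, hfit, hlay, sup_bot_eq, hbot]

theorem isFittingDegenerate_quotient_iff [CompactSpace G] [TotallyDisconnectedSpace G]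
    {N : Subgroup G} [N.Normal] (hN : IsClosed (N : Set G)) :
    IsFittingDegenerate (G ⧸ N) ↔
      (∀ H, IsCoreMod N H → H ≤ N) ∧ ∀ d H, ¬ IsComponentMod d N H := by
  have : T3Space (G ⧸ N) := QuotientGroup.instT3Space N
  rw [isFittingDegenerate_iff]
  refine and_congr ⟨fun h H hH => ?_, fun h H hH => ?_⟩ ⟨fun h d H hH => ?_, fun h Q hQ => ?_⟩
  · rw [← comap_map_mk hH.le] at hH
    have := h _ ((isCoreMod_comap_iff hN).1 hH)
    rwa [Subgroup.map_eq_bot_iff, QuotientGroup.ker_mk'] at this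
  · have := h _ ((isCoreMod_comap_iff hN).2 hH)
    exact le_bot_iff.1 (comap_mk_le_iff.1 (this.trans comap_mk_bot.ge))
  · rw [← comap_map_mk hH.le] at hH
    exact h _ (isComponent_iff.2 ⟨d, isComponentMod_bot_iff.2 hH⟩)
  · obtain ⟨d, hd⟩ := isComponent_iff.1 hQ
    exact h d _ (isComponentMod_bot_iff.1 hd)

end Quotient

/-! ### Countable intersections and the inductive step. -/

variable {G : Type*} [Group G] [TopologicalSpace G] [IsTopologicalGroup G]

theorem IsComponentMod.mono {d e : ℕ} (hde : d ≤ e) {M H : Subgroup G}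
    (h : IsComponentMod d M H) : IsComponentMod e M H :=
  { h with subnormal := (iterNormalClosure_antitone H hde).trans h.subnormal }

variable [CompactSpace G]

/-- The quotient is compact and injects continuously into a countable product of finite discrete
groups, so the injection is an embedding. -/
theorem secondCountableTopology_quotient_iInf (N : ℕ → Subgroup G) [∀ i, (N i).Normal]
    [(⨅ i, N i).Normal] (hN : ∀ i, IsOpen (N i : Set G)) :
    SecondCountableTopology (G ⧸ ⨅ i, N i) := by
  have hd : ∀ i, DiscreteTopology (G ⧸ N i) := fun i => QuotientGroup.discreteTopology (hN i)
  have hf : ∀ i, Finite (G ⧸ N i) := fun i => Subgroup.quotient_finite_of_isOpen _ (hN i)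
  let f : (G ⧸ ⨅ i, N i) → ∀ i, G ⧸ N i := fun x i =>
    QuotientGroup.map (⨅ i, N i) (N i) (MonoidHom.id G) (iInf_le N i) x
  have hfc : Continuous f := by
    refine continuous_pi fun i => (QuotientGroup.isQuotientMap_mk _).continuous_iff.2 ?_
    exact QuotientGroup.continuous_mk (N := N i)
  have hfi : Function.Injective f := by
    intro x y hxy
    obtain ⟨x, rfl⟩ := QuotientGroup.mk_surjective x
    obtain ⟨y, rfl⟩ := QuotientGroup.mk_surjective y
    rw [QuotientGroup.eq, Subgroup.mem_iInf]
    exact fun i => QuotientGroup.eq.1 (congrFun hxy i)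
  exact (hfc.isClosedEmbedding hfi).isEmbedding.secondCountableTopology

variable [TotallyDisconnectedSpace G]

theorem exists_isOpen_forall_le (d : ℕ) {K N₀ : Subgroup G} [K.Normal] [N₀.Normal]
    (hK : IsClosed (K : Set G)) (hN₀ : IsOpen (N₀ : Set G)) (hKN₀ : K ≤ N₀)
    (hcore : ∀ H, IsCoreMod K H → H ≤ K) (hcomp : ∀ H, ¬ IsComponentMod d K H) :
    ∃ M : Subgroup G, M.Normal ∧ IsOpen (M : Set G) ∧ K ≤ M ∧ M ≤ N₀ ∧
      ∀ H, IsCoreMod M H ∨ IsComponentMod d M H → H ≤ N₀ := by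
  obtain ⟨A, hA, hAo, hKA, hAN, hA'⟩ := exists_isOpen_forall_isCoreMod_le hN₀ hKN₀ hcore
  obtain ⟨B, hB, hBo, hKB, hBN, hB'⟩ :=
    exists_isOpen_forall_isComponentMod_le d hK hN₀ hKN₀ hcomp
  refine ⟨A ⊓ B, inferInstance, hAo.inter hBo, le_inf hKA hKB, inf_le_left.trans hAN, ?_⟩
  rintro H (h | h)
  · exact le_sup_left.trans (hA' _ (h.sup hAo inf_le_left))
  -- A component may become trivial modulo `B`; it then lies in `N₀` already.
  · by_cases hHB : H ≤ B
    · exact hHB.trans hBN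
    · exact le_sup_left.trans (hB' _ (h.sup hBo inf_le_right hHB))

end Profin

/-! ### The descending chain and its intersection. -/

theorem theoremE (G : Type*) [Group G] [TopologicalSpace G] [IsTopologicalGroup G]
    [CompactSpace G] [TotallyDisconnectedSpace G] (hG : ¬ Profin.IsFittingRegular G) :
    ∃ (N : Subgroup G) (_ : N.Normal), IsClosed (N : Set G) ∧ Nontrivial (G ⧸ N) ∧
      SecondCountableTopology (G ⧸ N) ∧ Profin.IsFittingDegenerate (G ⧸ N) := by
  rw [Profin.IsFittingRegular] at hG
  push Not at hG
  obtain ⟨K, hKn, hK, hnt, hdeg⟩ := hG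
  obtain ⟨hcore, hcomp⟩ := (Profin.isFittingDegenerate_quotient_iff hK).1 hdeg
  have hKtop : ∃ x : G, x ∉ K := by
    obtain ⟨x, hx⟩ := exists_ne (1 : G ⧸ K)
    obtain ⟨x, rfl⟩ := QuotientGroup.mk_surjective x
    exact ⟨x, fun h => hx ((QuotientGroup.eq_one_iff x).2 h)⟩
  obtain ⟨x, hx⟩ := hKtop
  -- Starting from a subgroup that omits `x` keeps the final quotient nontrivial.
  obtain ⟨N₀, h1, h2, h3, h4⟩ := Profin.exists_isOpen_normal_ge hK
    (isClosed_singleton (x := x)).isOpen_compl (fun y hy h => hx (h ▸ hy))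
  let S := {M : Subgroup G // M.Normal ∧ IsOpen (M : Set G) ∧ K ≤ M}
  have hstep : ∀ (d : ℕ) (A : S), ∃ B : S, B.1 ≤ A.1 ∧
      ∀ H, Profin.IsCoreMod B.1 H ∨ Profin.IsComponentMod d B.1 H → H ≤ A.1 := by
    rintro d ⟨A, hA, hAo, hKA⟩
    obtain ⟨B, g1, g2, g3, g4, g5⟩ :=
      Profin.exists_isOpen_forall_le d hK hAo hKA hcore (hcomp d)
    exact ⟨⟨B, g1, g2, g3⟩, g4, g5⟩
  choose next hnext_le hnext using hstep
  -- Stage `n` handles components of depth at most `n`, so each fixed depth is handled at all but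
  -- finitely many stages.
  let s : ℕ → S := fun n => Nat.rec ⟨N₀, h1, h2, h3⟩ next n
  let N : ℕ → Subgroup G := fun n => (s n).1
  have hN : ∀ n, (N n).Normal := fun n => (s n).2.1
  have hNo : ∀ n, IsOpen (N n : Set G) := fun n => (s n).2.2.1
  have hNanti : Antitone N := antitone_nat_of_succ_le fun n => hnext_le n (s n)
  have hNnext : ∀ n H, Profin.IsCoreMod (N (n + 1)) H ∨
      Profin.IsComponentMod n (N (n + 1)) H → H ≤ N n := fun n => hnext n (s n)
  have hN0 : N 0 = N₀ := rfl
  clear_value N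
  have hInf : (⨅ n, N n).Normal := Subgroup.normal_iInf_normal hN
  have hInfc : IsClosed ((⨅ n, N n : Subgroup G) : Set G) := by
    rw [Subgroup.coe_iInf]
    exact isClosed_iInter fun n => Subgroup.isClosed_of_isOpen _ (hNo n)
  have hxN : x ∉ ⨅ n, N n := fun h => h4 (hN0 ▸ iInf_le N 0 h) rfl
  refine ⟨⨅ n, N n, hInf, hInfc, ⟨⟨x, 1, fun h => hxN ((QuotientGroup.eq_one_iff x).1 h)⟩⟩,
    Profin.secondCountableTopology_quotient_iInf N hNo,
    (Profin.isFittingDegenerate_quotient_iff hInfc).2 ⟨fun H hH => le_iInf fun n => ?_,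
      fun d H hH => hH.not_le ?_⟩⟩
  · exact le_sup_left.trans (hNnext n _ (Or.inl (hH.sup (hNo (n + 1)) (iInf_le N (n + 1)))))
  · by_contra hle
    have : ∃ m, ¬ H ≤ N m := by
      by_contra! h
      exact hle (le_iInf h)
    obtain ⟨m, hm⟩ := this
    -- The stage must be at least `m`, so that `H` is not contained in that term, and at least `d`,
    -- so that the depth bound applies.
    have hmd : ¬ H ≤ N (max m d) := fun h => hm (h.trans (hNanti (le_max_left m d)))
    have hmd' : ¬ H ≤ N (max m d + 1) := fun h => hmd (h.trans (hNanti (Nat.le_succ _)))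
    exact hmd (le_sup_left.trans (hNnext _ _ (Or.inr
      ((hH.mono (le_max_right m d)).sup (hNo _) (iInf_le N (max m d + 1)) hmd'))))
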